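/- Let $G=(V,E)$ be a finite decomposable graph (every cycle of length at least $4$ has a chord), let $\mathcal I_v$, $v\in V$, be finite sets, and let $\mathcal I=\prod_{v\in V}\mathcal I_v$ be the set of cells; for $D\subset V$ write $\mathcal I_D=\prod_{v\in D}\mathcal I_v$. Let $\mathbf p=(\mathbf p(\underline i))_{\underline i\in\mathcal I}$ be a vector of random cell probabilities associated with $G$: a random vector such that almost surely $\mathbf p(\underline i)>0$ for all $\underline i\in\mathcal I$, $\sum_{\underline i}\mathbf p(\underline i)=1$, and a vector $X=(X_v)_{v\in V}$ with $\mathbb P_{\mathbf p}(X=\underline i)=\mathbf p(\underline i)$ is Markov with respect to $G$, that is, $X_u$ and $X_w$ are conditionally independent given $X_{V\setminus\{u,w\}}$ under $\mathbb P_{\mathbf p}$ for all distinct non-adjacent $u,w\in V$. A moral DAG with skeleton $G$ is given by its parent function $\mathfrak p$, $v\mapsto\mathfrak p_v\subset V$: the directed graph with arrows $u\to v$ for $u\in\mathfrak p_v$ is acyclic, its underlying undirected graph is $G$, and any two distinct parents of the same vertex are adjacent. For such $\mathfrak p$, $v\in V$ and $\underline k\in\mathcal I_{\mathfrak p_v}$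 put $$\mathbf p^{v|\mathfrak p_v}_{\cdot|\underline k}=\bigl(\mathbb P_{\mathbf p}(X_v=m\mid X_{\mathfrak p_v}=\underline k)\bigr)_{m\in\mathcal I_v}.$$ Parameter independence holds for $\mathbf p$ with respect to $\mathfrak p$ if the following random vectors are independent and non-degenerate (not almost surely constant): for each $v\in V$, the vectors $\mathbf p^{v|\mathfrak p_v}_{\cdot|\underline k}$, $\underline k\in\mathcal I_{\mathfrak p_v}$ (local independence); and the vectors $(\mathbf p^{v|\mathfrak p_v}_{\cdot|\underline k})_{\underline k\in\mathcal I_{\mathfrak p_v}}$, $v\in V$ (global independence). Let $\mathcal P$ be a family of moral DAGs with skeleton $G$ which is separating: for every $v\in V$ there are $\mathfrak p,\mathfrak p'\in\mathcal P$ with $\mathfrak p_v\neq\mathfrak p'_v$. If parameter independence holds for $\mathbf p$ with respect to every $\mathfrak p\in\mathcal P$, then $\mathbf p$ has a $\mathcal P$-Dirichlet distribution, that is, for every $\mathfrak p\in\mathcal P$, almost surely $$\mathbf p(\underline i)=\prod_{v\in V}\mathbf p^{v|\mathfrak p_v}_{i_v|\underline i_{\mathfrak p_v}}\qquad(\underline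 i\in\mathcal I),$$ and the random vectors $\mathbf p^{v|\mathfrak p_v}_{\cdot|\underline k}$, $v\in V$, $\underline k\in\mathcal I_{\mathfrak p_v}$, are jointly independent, each of them having a classical Dirichlet distribution with some positive parameters. (No density of $\mathbf p$ is assumed.) -/

import Mathlib

open MeasureTheory ProbabilityTheory

namespace PDirichlet

noncomputable section

/-! ### Graphs and DAGs -/

section Graphs

variable {V : Type*}

/-- `G` is decomposable (chordal): every cycle of length at least `4` has a chord. -/
def IsDecomposable (G : SimpleGraph V) : Prop :=
  ∀ (v : V) (c : G.Walk v v), c.IsCycle → 4 ≤ c.length → ¬ c.IsChordless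

/-- `pa` is the parent function of a moral DAG with skeleton `G`: the directed graph with the
arrows `u ⟶ v` for `u ∈ pa v` has no directed cycle, its underlying undirected graph is `G`, and
two distinct parents of the same vertex are adjacent. -/
structure IsMoralDAG (G : SimpleGraph V) (pa : V → Finset V) : Prop where
  acyclic : ∀ v, ¬ Relation.TransGen (fun u w => u ∈ pa w) v v
  skeleton : ∀ u v, G.Adj u v ↔ u ∈ pa v ∨ v ∈ pa u
  moral : ∀ w, ∀ u ∈ pa w, ∀ v ∈ pa w, u ≠ v → G.Adj u v

/-- A family of DAGs (given by their parent functions) is separating if every vertex has different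
parent sets in two members of the family. -/
def IsSeparating (P : Set (V → Finset V)) : Prop :=
  ∀ v, ∃ pa ∈ P, ∃ pa' ∈ P, pa v ≠ pa' v

end Graphs

/-! ### Cell probabilities. The set of cells is `∀ v, I v`, and `q i` is `ℙ (X = i)`. -/

section Cells

variable {V : Type*} [Fintype V] [DecidableEq V] {I : V → Type*} [∀ v, Fintype (I v)]

/-- `ℙ (X ∈ A)` under the table `q` of cell probabilities. -/
def prob (q : (∀ v, I v) → ℝ) (A : Set (∀ v, I v)) : ℝ := ∑ i, A.indicator q i

/-- `ℙ (X ∈ A | X ∈ B)`. -/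
def condProb (q : (∀ v, I v) → ℝ) (A B : Set (∀ v, I v)) : ℝ := prob q (A ∩ B) / prob q B

/-- `X` is Markov with respect to `G`: `X u` and `X w` are conditionally independent given all
the other coordinates of `X`, for any two distinct non-adjacent vertices `u` and `w`. -/
def IsMarkov (G : SimpleGraph V) (q : (∀ v, I v) → ℝ) : Prop :=
  ∀ u w, u ≠ w → ¬ G.Adj u w → ∀ i : ∀ v, I v,
    condProb q {j | j u = i u ∧ j w = i w} {j | ∀ v, v ≠ u → v ≠ w → j v = i v} =
      condProb q {j | j u = i u} {j | ∀ v, v ≠ u → v ≠ w → j v = i v} *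
        condProb q {j | j w = i w} {j | ∀ v, v ≠ u → v ≠ w → j v = i v}

/-- `ℙ (X v = m | X_{pa v} = k)`. -/
def condParam (q : (∀ v, I v) → ℝ) (pa : V → Finset V) (v : V) (k : ∀ w : pa v, I w) (m : I v) :
    ℝ :=
  condProb q {j | j v = m} {j | ∀ w : pa v, j w = k w}

end Cells

/-! ### The classical Dirichlet distribution -/

section Dirichlet

variable {ι : Type*} [Fintype ι] [DecidableEq ι]

/-- The vector with coordinates `x m` for `m ≠ m₀` whose coordinate sum is `1`. -/
def complete (m₀ : ι) (x : {m // m ≠ m₀} → ℝ) (m : ι) : ℝ :=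
  if h : m = m₀ then 1 - ∑ j, x j else x ⟨m, h⟩

open Classical in
/-- The Dirichlet density in the coordinates other than `m₀`. It is supported by
`{x | (∀ m, 0 < x m) ∧ ∑ m, x m < 1}`, i.e. by the `x` whose completion is positive. -/
def dirichletDensity (α : ι → ℝ) (m₀ : ι) (x : {m // m ≠ m₀} → ℝ) : ℝ :=
  if ∀ m, 0 < complete m₀ x m then
    Real.Gamma (∑ m, α m) / (∏ m, Real.Gamma (α m)) * ∏ m, complete m₀ x m ^ (α m - 1)
  else 0

/-- The Dirichlet distribution with parameters `α`, as a measure on `ι → ℝ` (concentrated on the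
unit simplex). -/
def dirichletMeasure (α : ι → ℝ) (m₀ : ι) : Measure (ι → ℝ) :=
  ((volume : Measure ({m // m ≠ m₀} → ℝ)).withDensity
    (fun x => ENNReal.ofReal (dirichletDensity α m₀ x))).map (complete m₀)

/-- `ν` is a classical Dirichlet distribution on the unit simplex of `ι → ℝ`, with some positive
parameters; the coordinate `m₀` which is eliminated in order to write the density is arbitrary. -/
def IsDirichlet (ν : Measure (ι → ℝ)) : Prop :=
  Nonempty ι ∧ ∃ α : ι → ℝ, (∀ m, 0 < α m) ∧ ∀ m₀, ν = dirichletMeasure α m₀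

end Dirichlet

/-! ### Random cell probabilities -/

section Random

variable {V : Type*} [Fintype V] [DecidableEq V] {I : V → Type*} [∀ v, Fintype (I v)]
  {Ω : Type*} [MeasurableSpace Ω]

/-- `p` is a vector of random (positive) cell probabilities associated with the graph `G`. -/
structure IsAssociated (G : SimpleGraph V) (p : Ω → (∀ v, I v) → ℝ) (μ : Measure Ω) : Prop where
  measurable : Measurable p
  pos : ∀ᵐ ω ∂μ, ∀ i, 0 < p ω i
  sum_eq_one : ∀ᵐ ω ∂μ, ∑ i, p ω i = 1
  markov : ∀ᵐ ω ∂μ, IsMarkov G (p ω)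

/-- A random element is non-degenerate if it is not almost surely constant. -/
def Nondegenerate {E : Type*} (Y : Ω → E) (μ : Measure Ω) : Prop :=
  ¬ ∃ c : E, ∀ᵐ ω ∂μ, Y ω = c

/-- For each vertex `v`, the random vectors `(ℙ (X v = m | X_{pa v} = k))_m`, indexed by `k`, are
independent and non-degenerate. -/
def LocalParameterIndependence (pa : V → Finset V) (p : Ω → (∀ v, I v) → ℝ) (μ : Measure Ω) :
    Prop :=
  ∀ v, iIndepFun (fun (k : ∀ w : pa v, I w) ω => condParam (p ω) pa v k) μ ∧
    ∀ k : ∀ w : pa v, I w, Nondegenerate (fun ω => condParam (p ω) pa v k) μ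

/-- The random vectors `(ℙ (X v = m | X_{pa v} = k))_{k, m}`, indexed by `v`, are independent and
non-degenerate. -/
def GlobalParameterIndependence (pa : V → Finset V) (p : Ω → (∀ v, I v) → ℝ) (μ : Measure Ω) :
    Prop :=
  iIndepFun (fun v ω => condParam (p ω) pa v) μ ∧
    ∀ v, Nondegenerate (fun ω => condParam (p ω) pa v) μ

/-- Parameter independence with respect to the DAG with parent function `pa`. -/
def ParameterIndependence (pa : V → Finset V) (p : Ω → (∀ v, I v) → ℝ) (μ : Measure Ω) : Prop :=
  LocalParameterIndependence pa p μ ∧ GlobalParameterIndependence pa p μ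

variable [∀ v, DecidableEq (I v)]

/-- `p` has a `pa`-Dirichlet distribution: it is associated with `G`, it is almost surely the
product of the conditional probabilities of each vertex given its parents, and the random vectors
`(ℙ (X v = m | X_{pa v} = k))_m`, indexed by all pairs `(v, k)`, are independent and follow
classical Dirichlet distributions. -/
structure IsDAGDirichlet (G : SimpleGraph V) (pa : V → Finset V) (p : Ω → (∀ v, I v) → ℝ)
    (μ : Measure Ω) : Prop where
  associated : IsAssociated G p μ
  rep : ∀ᵐ ω ∂μ, ∀ i, p ω i = ∏ v, condParam (p ω) pa v (fun w => i w) (i v)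
  indep : iIndepFun
    (fun (x : Σ v, ∀ w : pa v, I w) ω => condParam (p ω) pa x.1 x.2) μ
  dirichlet : ∀ v, ∀ k : ∀ w : pa v, I w, IsDirichlet (μ.map fun ω => condParam (p ω) pa v k)

/-- `p` has a `P`-Dirichlet distribution: it has a `pa`-Dirichlet distribution for each member `pa`
of the family `P`. -/
def IsFamilyDirichlet (G : SimpleGraph V) (P : Set (V → Finset V)) (p : Ω → (∀ v, I v) → ℝ)
    (μ : Measure Ω) : Prop :=
  ∀ pa ∈ P, IsDAGDirichlet G pa p μ

end Random

end

end PDirichlet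

/-!
The pairwise Markov property of a positive table gives the factorization along every moral DAG, by
removing sinks one at a time. Under parameter independence the moment `E ∏ i, p i ^ n i` is
therefore, along each DAG, a product of moments of the conditional vectors, taken at the counts
of the parent configurations in a sample with cell counts `n`.

Take multiplicative mixed differences (cross ratios) of this moment at a sample in which only the
value at the vertex `v` varies. In the product expression every factor except the one at `v` then
sees the total count only. Comparing two DAGs in which `v` has different parents, one finds that
the cross ratios of the moments of the conditional vector at `v` depend on the degree only. This is
W. E. Johnson's sufficientness postulate: the ratios of consecutive moments are affine in the
counts, with positive slope because the vector is not constant, so the moments are those of a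
Dirichlet distribution, and moments determine a law on the simplex by the Stone–Weierstrass theorem.
-/

namespace PDirichlet

noncomputable section

/-! ### Marginals and factorization along a DAG -/

section Marginals

variable {V : Type*} [Fintype V] [DecidableEq V] {I : V → Type*} [∀ v, Fintype (I v)]
  {q : (∀ v, I v) → ℝ}

/-- The marginal table of `q` on `B`, namely `ℙ (X = i on B)`, encoded as a function of a whole
cell `i` so that no table indexed by the cells of `B` is needed. -/
def marginal (q : (∀ v, I v) → ℝ) (B : Finset V) (i : ∀ v, I v) : ℝ :=
  prob q {j | ∀ w ∈ B, j w = i w}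

lemma prob_pos (hq : ∀ i, 0 < q i) {A : Set (∀ v, I v)} (hA : A.Nonempty) : 0 < prob q A := by
  obtain ⟨i, hi⟩ := hA
  refine Finset.sum_pos' (fun j _ => Set.indicator_nonneg (fun j _ => (hq j).le) j)
    ⟨i, Finset.mem_univ _, ?_⟩
  rw [Set.indicator_of_mem hi]
  exact hq i

lemma marginal_pos (hq : ∀ i, 0 < q i) (B : Finset V) (i : ∀ v, I v) : 0 < marginal q B i :=
  prob_pos hq ⟨i, fun _ _ => rfl⟩

lemma marginal_empty (q : (∀ v, I v) → ℝ) (i : ∀ v, I v) : marginal q ∅ i = ∑ j, q j := by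
  simp [marginal, prob]

lemma marginal_univ (q : (∀ v, I v) → ℝ) : marginal q Finset.univ = q := by
  classical
  funext i
  have : {j : ∀ v, I v | ∀ w ∈ Finset.univ, j w = i w} = {i} := by
    ext j
    simp [funext_iff]
  rw [marginal, this]
  simp [prob, Set.indicator_apply]

lemma marginal_update_of_notMem (q : (∀ v, I v) → ℝ) {B : Finset V} {w : V} (hw : w ∉ B)
    (i : ∀ v, I v) (a : I w) : marginal q B (Function.update i w a) = marginal q B i := by
  refine congrArg (prob q) (Set.ext fun j => forall₂_congr fun u hu => ?_)
  rw [Function.update_of_ne (ne_of_mem_of_not_mem hu hw)]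

lemma sum_prob_inter_fiber (q : (∀ v, I v) → ℝ) (A : Set (∀ v, I v)) (w : V) :
    ∑ a, prob q (A ∩ {j | j w = a}) = prob q A := by
  classical
  simp only [prob]
  rw [Finset.sum_comm]
  refine Finset.sum_congr rfl fun j _ => ?_
  by_cases hj : j ∈ A <;> simp [Set.indicator_apply, hj]

lemma sum_marginal_insert_update (q : (∀ v, I v) → ℝ) {B : Finset V} {w : V} (hw : w ∉ B)
    (i : ∀ v, I v) :
    ∑ a, marginal q (insert w B) (Function.update i w a) = marginal q B i := by
  rw [marginal, ← sum_prob_inter_fiber q _ w]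
  refine Finset.sum_congr rfl fun a _ => congrArg (prob q) ?_
  ext j
  have (u : V) (hu : u ∈ B) : Function.update i w a u = i u :=
    Function.update_of_ne (ne_of_mem_of_not_mem hu hw) _ _
  simp +contextual [this, and_comm]

lemma condParam_eq_marginal_div (q : (∀ v, I v) → ℝ) (pa : V → Finset V) (v : V)
    (i : ∀ v, I v) :
    condParam q pa v (fun w => i w) (i v) =
      marginal q (insert v (pa v)) i / marginal q (pa v) i := by
  simp only [condParam, condProb, marginal]
  congr 2 <;> ext j <;> simp

lemma condParam_update_of_notMem (q : (∀ v, I v) → ℝ) {pa : V → Finset V} {u v : V}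
    (hu : u ∉ insert v (pa v)) (i : ∀ v, I v) (a : I u) :
    condParam q pa v (fun w => Function.update i u a w) (Function.update i u a v) =
      condParam q pa v (fun w => i w) (i v) := by
  rw [condParam_eq_marginal_div, condParam_eq_marginal_div, marginal_update_of_notMem q hu,
    marginal_update_of_notMem q fun h => hu (Finset.mem_insert_of_mem h)]

end Marginals

section NoInteraction

variable {V : Type*} [DecidableEq V] {I : V → Type*} {F : (∀ v, I v) → ℝ} {u w : V}

/-- The coordinates `u` and `w` have no interaction in `F`: all the `2 × 2` minors of `F` in these
two coordinates vanish. For a positive table this is conditional independence of the two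
coordinates given all the others. -/
def NoInteraction (F : (∀ v, I v) → ℝ) (u w : V) : Prop :=
  ∀ i a b, F i * F (Function.update (Function.update i u a) w b) =
    F (Function.update i u a) * F (Function.update i w b)

lemma NoInteraction.symm (huw : u ≠ w) (h : NoInteraction F u w) : NoInteraction F w u := by
  intro i a b
  rw [Function.update_comm huw.symm, h, mul_comm]

lemma noInteraction_mul (huw : u ≠ w) {A B : (∀ v, I v) → ℝ}
    (hA : ∀ i a, A (Function.update i w a) = A i) (hB : ∀ i a, B (Function.update i u a) = B i) :
    NoInteraction (fun i => A i * B i) u w := by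
  intro i a b
  dsimp only
  rw [hA, hA, Function.update_comm huw, hB, hB]
  ring

lemma NoInteraction.of_mul_left (huw : u ≠ w) {c : (∀ v, I v) → ℝ} (hc : ∀ i, c i ≠ 0)
    (hcu : ∀ i a, c (Function.update i u a) = c i)
    (h : NoInteraction (fun i => c i * F i) u w) : NoInteraction F u w := by
  intro i a b
  have := h i a b
  simp only [Function.update_comm huw, hcu] at this
  rw [← Function.update_comm huw] at this
  refine mul_left_cancel₀ (mul_ne_zero (hc i) (hc (Function.update i w b))) ?_
  linear_combination this

end NoInteraction

section Sinks

variable {V : Type*} [Finite V] {G : SimpleGraph V} {pa : V → Finset V}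

lemma IsMoralDAG.exists_sink (h : IsMoralDAG G pa) {A : Finset V} (hA : A.Nonempty) :
    ∃ v ∈ A, ∀ w ∈ A, v ∉ pa w := by
  let R : V → V → Prop := fun a b => Relation.TransGen (fun u w => u ∈ pa w) b a
  have : IsTrans V R := ⟨fun a b c hab hbc => hbc.trans hab⟩
  have : Std.Irrefl R := ⟨fun a ha => h.acyclic a ha⟩
  have wf : WellFounded R := Finite.wellFounded_of_trans_of_irrefl R
  obtain ⟨v, hv, hmin⟩ := wf.has_min (A : Set V) hA
  exact ⟨v, hv, fun w hw hvw => hmin w hw (Relation.TransGen.single hvw)⟩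

end Sinks

section Factorization

variable {V : Type*} [Fintype V] [DecidableEq V] {I : V → Type*} [∀ v, Fintype (I v)]
  {q : (∀ v, I v) → ℝ} {G : SimpleGraph V} {pa : V → Finset V}

lemma IsMarkov.mul_marginal_compl (hG : IsMarkov G q) (hq : ∀ i, 0 < q i) {u w : V}
    (huw : u ≠ w) (hadj : ¬ G.Adj u w) (i : ∀ v, I v) :
    q i * marginal q {u, w}ᶜ i = marginal q {w}ᶜ i * marginal q {u}ᶜ i := by
  have hK : {j : ∀ v, I v | ∀ v, v ≠ u → v ≠ w → j v = i v} =
      {j | ∀ v ∈ ({u, w}ᶜ : Finset V), j v = i v} := by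
    ext j
    simp
  have hins (x : V) (B : Finset V) : {j : ∀ v, I v | j x = i x} ∩ {j | ∀ v ∈ B, j v = i v} =
      {j | ∀ v ∈ insert x B, j v = i v} := by
    ext j
    simp
  have hu : insert u ({u, w}ᶜ : Finset V) = {w}ᶜ := by grind [Finset.mem_compl]
  have hw : insert w ({u, w}ᶜ : Finset V) = {u}ᶜ := by grind [Finset.mem_compl]
  have h := hG u w huw hadj i
  simp only [condProb, hK, Set.ofPred_and, Set.inter_assoc, hins, hu, hw, Finset.insert_compl_self,
    ← marginal.eq_def, marginal_univ] at h
  rw [div_mul_div_comm, div_eq_div_iff (marginal_pos hq _ i).ne'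
    (mul_pos (marginal_pos hq _ i) (marginal_pos hq _ i)).ne', ← mul_assoc] at h
  exact mul_right_cancel₀ (marginal_pos hq _ i).ne' h

lemma IsMarkov.noInteraction (hG : IsMarkov G q) (hq : ∀ i, 0 < q i) {u w : V} (huw : u ≠ w)
    (hadj : ¬ G.Adj u w) : NoInteraction q u w := by
  have hfac : q = fun i => marginal q {w}ᶜ i / marginal q {u, w}ᶜ i * marginal q {u}ᶜ i := by
    funext i
    rw [div_mul_eq_mul_div, eq_div_iff (marginal_pos hq _ i).ne',
      hG.mul_marginal_compl hq huw hadj]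
  rw [hfac]
  refine noInteraction_mul huw (fun i a => ?_) fun i a => marginal_update_of_notMem q (by simp) i a
  rw [marginal_update_of_notMem q (by simp), marginal_update_of_notMem q (by simp)]

lemma marginal_insert_sdiff_eq_mul {v : V} {B : Finset V} (hv : v ∉ B) {ρ : (∀ v, I v) → ℝ}
    (h : ∀ i, marginal q (insert v B) i = ρ i * marginal q B i) {D : Finset V} (hDB : D ⊆ B)
    (hρ : ∀ w ∈ D, ∀ i a, ρ (Function.update i w a) = ρ i) (i : ∀ v, I v) :
    marginal q (insert v (B \ D)) i = ρ i * marginal q (B \ D) i := by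
  induction D using Finset.induction_on generalizing i with
  | empty => simpa using h i
  | insert w D hw ih =>
    have hwB : w ∈ B := hDB (Finset.mem_insert_self w D)
    have hwv : w ≠ v := ne_of_mem_of_not_mem hwB hv
    have hins : insert w (B \ insert w D) = B \ D := by grind
    rw [← sum_marginal_insert_update q (w := w) (B := insert v (B \ insert w D)) (by grind),
      ← sum_marginal_insert_update q (w := w) (B := B \ insert w D) (by grind),
      Finset.insert_comm, hins, Finset.mul_sum]
    refine Finset.sum_congr rfl fun a _ => ?_
    rw [ih ((Finset.subset_insert _ _).trans hDB) fun u hu => hρ u (Finset.mem_insert_of_mem hu),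
      hρ w (Finset.mem_insert_self w D)]

lemma marginal_insert_div_update (hq : ∀ i, 0 < q i) {v w : V} {B : Finset V} (hv : v ∉ B)
    (hvw : v ≠ w) (h : NoInteraction (marginal q (insert v B)) v w) (i : ∀ v, I v) (a : I w) :
    marginal q (insert v B) (Function.update i w a) / marginal q B (Function.update i w a) =
      marginal q (insert v B) i / marginal q B i := by
  rw [div_eq_div_iff (marginal_pos hq _ _).ne' (marginal_pos hq _ _).ne',
    ← sum_marginal_insert_update q hv, ← sum_marginal_insert_update q hv, Finset.mul_sum,
    Finset.mul_sum]
  refine Finset.sum_congr rfl fun m _ => ?_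
  rw [Function.update_comm hvw.symm, h, mul_comm]

lemma marginal_insert_mul_marginal (hq : ∀ i, 0 < q i) {v : V} {B S : Finset V}
    (hv : v ∉ B) (hS : S ⊆ B)
    (hvw : ∀ w ∈ B \ S, NoInteraction (marginal q (insert v B)) v w) (i : ∀ v, I v) :
    marginal q (insert v B) i * marginal q S i = marginal q (insert v S) i * marginal q B i := by
  have h := marginal_insert_sdiff_eq_mul (q := q) hv (D := B \ S)
    (ρ := fun i => marginal q (insert v B) i / marginal q B i)
    (fun i => (div_mul_cancel₀ _ (marginal_pos hq B i).ne').symm) Finset.sdiff_subset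
    (fun w hw => marginal_insert_div_update hq hv
      (ne_of_mem_of_not_mem (Finset.mem_sdiff.1 hw).1 hv).symm (hvw w hw)) i
  rw [Finset.sdiff_sdiff_eq_self hS] at h
  have hB := (marginal_pos hq B i).ne'
  rw [h]
  field_simp

/-- The pairwise Markov property, with respect to the subgraph of `G` induced by `A`, of the
marginal of `q` on `A`. It is inherited when a sink of `A` is removed. -/
def IsMarkovOn (G : SimpleGraph V) (q : (∀ v, I v) → ℝ) (A : Finset V) : Prop :=
  ∀ u ∈ A, ∀ w ∈ A, u ≠ w → ¬ G.Adj u w → NoInteraction (marginal q A) u w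

lemma IsMarkovOn.marginal_eq_condParam_mul {A : Finset V} (hA : IsMarkovOn G q A)
    (hq : ∀ i, 0 < q i) (hpa : IsMoralDAG G pa) {v : V} (hv : v ∈ A) (hvpa : pa v ⊆ A)
    (hsink : ∀ w ∈ A, v ∉ pa w) (i : ∀ v, I v) :
    marginal q A i = condParam q pa v (fun w => i w) (i v) * marginal q (A.erase v) i := by
  have hins : insert v (A.erase v) = A := Finset.insert_erase hv
  have hsub : pa v ⊆ A.erase v := Finset.subset_erase.2 ⟨hvpa, hsink v hv⟩
  have hint : ∀ w ∈ A.erase v \ pa v, NoInteraction (marginal q (insert v (A.erase v))) v w := by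
    intro w hw
    obtain ⟨⟨hwv, hwA⟩, hwpa⟩ := by simpa only [Finset.mem_sdiff, Finset.mem_erase] using hw
    rw [hins]
    refine hA v hv w hwA (Ne.symm hwv) ?_
    rw [hpa.skeleton]
    exact fun h => h.elim (hsink w hwA) hwpa
  have h := marginal_insert_mul_marginal hq (Finset.notMem_erase v A) hsub hint i
  rwa [hins, ← eq_div_iff (marginal_pos hq _ _).ne', mul_div_right_comm,
    ← condParam_eq_marginal_div] at h

lemma IsMarkovOn.erase {A : Finset V} (hA : IsMarkovOn G q A)
    (hq : ∀ i, 0 < q i) (hpa : IsMoralDAG G pa) {v : V} (hv : v ∈ A) (hvpa : pa v ⊆ A)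
    (hsink : ∀ w ∈ A, v ∉ pa w) : IsMarkovOn G q (A.erase v) := by
  have hfac : marginal q A = fun i =>
      condParam q pa v (fun w => i w) (i v) * marginal q (A.erase v) i :=
    funext (hA.marginal_eq_condParam_mul hq hpa hv hvpa hsink)
  have hpos (i : ∀ v, I v) : condParam q pa v (fun w => i w) (i v) ≠ 0 := by
    rw [condParam_eq_marginal_div]
    exact (div_pos (marginal_pos hq _ _) (marginal_pos hq _ _)).ne'
  have key : ∀ u ∈ A.erase v, ∀ w ∈ A.erase v, u ≠ w → ¬ G.Adj u w → u ∉ pa v →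
      NoInteraction (marginal q (A.erase v)) u w := by
    intro u hu w hw huw hadj hupa
    refine NoInteraction.of_mul_left huw hpos (condParam_update_of_notMem q ?_) (hfac ▸
      hA u (Finset.mem_of_mem_erase hu) w (Finset.mem_of_mem_erase hw) huw hadj)
    simp [Finset.ne_of_mem_erase hu, hupa]
  intro u hu w hw huw hadj
  by_cases hupa : u ∈ pa v
  · have hwpa : w ∉ pa v := fun hwpa => hadj (hpa.moral v u hupa w hwpa huw)
    exact (key w hw u hu huw.symm (fun h => hadj h.symm) hwpa).symm huw.symm
  · exact key u hu w hw huw hadj hupa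

lemma IsMarkovOn.marginal_eq_prod_condParam {A : Finset V} (hA : IsMarkovOn G q A)
    (hq : ∀ i, 0 < q i) (hsum : ∑ i, q i = 1) (hpa : IsMoralDAG G pa)
    (hanc : ∀ v ∈ A, pa v ⊆ A) (i : ∀ v, I v) :
    marginal q A i = ∏ v ∈ A, condParam q pa v (fun w => i w) (i v) := by
  induction A using Finset.strongInduction with
  | H A ih =>
    rcases A.eq_empty_or_nonempty with rfl | hne
    · rw [marginal_empty, hsum, Finset.prod_empty]
    obtain ⟨v, hv, hsink⟩ := hpa.exists_sink hne
    rw [hA.marginal_eq_condParam_mul hq hpa hv (hanc v hv) hsink, ← Finset.mul_prod_erase A _ hv,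
      ih _ (Finset.erase_ssubset hv) (hA.erase hq hpa hv (hanc v hv) hsink) fun w hw =>
        Finset.subset_erase.2 ⟨hanc w (Finset.mem_of_mem_erase hw),
          hsink w (Finset.mem_of_mem_erase hw)⟩]

/-- The table `q` is the product of the conditional probabilities of each vertex given its
parents. -/
def FactorizesAlong (q : (∀ v, I v) → ℝ) (pa : V → Finset V) : Prop :=
  ∀ i, q i = ∏ v, condParam q pa v (fun w => i w) (i v)

lemma IsMarkov.factorizesAlong (hG : IsMarkov G q) (hq : ∀ i, 0 < q i) (hsum : ∑ i, q i = 1)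
    (hpa : IsMoralDAG G pa) : FactorizesAlong q pa := by
  have hA : IsMarkovOn G q Finset.univ := fun u _ w _ huw hadj => by
    rw [marginal_univ]
    exact hG.noInteraction hq huw hadj
  intro i
  rw [← hA.marginal_eq_prod_condParam hq hsum hpa (fun _ _ => Finset.subset_univ _) i,
    marginal_univ]

end Factorization

/-! ### Cross ratios and Johnson's sufficientness argument -/

section CrossRatio

variable {A : Type*} [AddCommMonoid A] {f : A → ℝ}

/-- The mixed multiplicative difference of `f` at `r` in the directions `a` and `b`. It turns a
product of functions of different statistics into a product of cross ratios, of which the ones of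
the functions that do not depend on both directions are `1`. -/
def crossRatio (f : A → ℝ) (r a b : A) : ℝ := f r * f (r + a + b) / (f (r + a) * f (r + b))

lemma crossRatio_pos (hf : ∀ r, 0 < f r) (r a b : A) : 0 < crossRatio f r a b :=
  div_pos (mul_pos (hf _) (hf _)) (mul_pos (hf _) (hf _))

lemma crossRatio_zero_left (hf : ∀ r, 0 < f r) (r b : A) : crossRatio f r 0 b = 1 := by
  rw [crossRatio, add_zero, div_self (mul_pos (hf _) (hf _)).ne']

lemma crossRatio_zero_right (hf : ∀ r, 0 < f r) (r a : A) : crossRatio f r a 0 = 1 := by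
  rw [crossRatio, add_zero, add_zero, mul_comm, div_self (mul_pos (hf _) (hf _)).ne']

lemma crossRatio_prod {X : Type*} [Fintype X] {B : X → Type*} [∀ x, AddCommMonoid (B x)]
    (f : ∀ x, B x → ℝ) (T : ∀ x, A →+ B x) (r a b : A) :
    crossRatio (fun r => ∏ x, f x (T x r)) r a b =
      ∏ x, crossRatio (f x) (T x r) (T x a) (T x b) := by
  simp only [crossRatio, map_add, Finset.prod_mul_distrib, Finset.prod_div_distrib]

end CrossRatio

section MultiIndex

variable {ι : Type*} [DecidableEq ι]

lemma multiIndex_induction [Finite ι] {Q : (ι → ℕ) → Prop} (zero : Q 0)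
    (add_single : ∀ r m, Q r → Q (r + Pi.single m 1)) (r : ι → ℕ) : Q r := by
  suffices ∀ s, Q s → Q (s + r) by simpa only [zero_add] using this 0 zero
  induction r using Pi.single_induction with
  | zero => simp
  | add f g hf hg => exact fun s hs => add_assoc s f g ▸ hg _ (hf s hs)
  | single m n =>
    intro s hs
    induction n with
    | zero => simpa using hs
    | succ n ih => simpa only [Pi.single_add, ← add_assoc] using add_single _ m ih

variable [Fintype ι]

lemma sum_add_single_one (r : ι → ℕ) (m : ι) :
    ∑ l, (r + Pi.single m 1 : ι → ℕ) l = ∑ l, r l + 1 := by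
  simp [Finset.sum_add_distrib]

lemma exists_forall_eq_add_nsmul [Nontrivial ι] {E : Type*} [AddCommGroup E]
    {g : ι → (ι → ℕ) → E} {S : ℕ → E}
    (hg : ∀ m m' r, m ≠ m' → g m (r + Pi.single m' 1) = g m r)
    (hS : ∀ r, ∑ m, g m r = S (∑ l, r l)) : ∃ c : E, ∀ m r, g m r = g m 0 + r m • c := by
  have hdiff (m : ι) (r : ι → ℕ) :
      g m (r + Pi.single m 1) - g m r = S (∑ l, r l + 1) - S (∑ l, r l) := by
    rw [← sum_add_single_one r m, ← hS, ← hS, ← Finset.sum_sub_distrib, Finset.sum_eq_single m]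
    · intro l _ hl
      rw [hg l m r hl, sub_self]
    · simp
  obtain ⟨m₁, m₂, h12⟩ := exists_pair_ne ι
  -- Raising the coordinate `m₂` changes the total count, but not the increment of `g m₁`.
  have hconst (n : ℕ) : S (n + 1) - S n = S 1 - S 0 := by
    induction n with
    | zero => rfl
    | succ n ih =>
      have h := hdiff m₁ (Pi.single m₁ n + Pi.single m₂ 1)
      rw [add_right_comm, hg _ _ _ h12, hg _ _ _ h12, hdiff, sum_add_single_one] at h
      simpa [ih] using h.symm
  refine ⟨S 1 - S 0, fun m r => ?_⟩
  induction r using multiIndex_induction with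
  | zero => simp
  | add_single r m' ih =>
    rcases eq_or_ne m m' with rfl | hm
    · rw [← sub_add_cancel (g m (r + Pi.single m 1)) (g m r), hdiff, hconst, ih]
      simp only [Pi.add_apply, Pi.single_eq_same, succ_nsmul]
      abel
    · rw [hg _ _ _ hm, ih]
      simp [hm]

/-- The cross ratios of `M` in two distinct coordinate directions depend on the multi-index only
through its degree. This is the form in which the comparison of two DAGs yields
W. E. Johnson's sufficientness postulate. -/
def CrossRatioDependsOnDegree (M : (ι → ℕ) → ℝ) : Prop :=
  ∃ H : ℕ → ℝ, ∀ r m m', m ≠ m' →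
    crossRatio M r (Pi.single m 1) (Pi.single m' 1) = H (∑ l, r l)

lemma CrossRatioDependsOnDegree.exists_affine_ratio [Nontrivial ι] {M : (ι → ℕ) → ℝ}
    (hM : CrossRatioDependsOnDegree M) (hpos : ∀ r, 0 < M r)
    (hsum : ∀ r, ∑ m, M (r + Pi.single m 1) = M r) :
    ∃ α : ι → ℝ, ∃ c : ℝ, (∀ m, 0 < α m) ∧ 0 ≤ c ∧
      ∀ r m, M (r + Pi.single m 1) * (∑ l, α l + c * (∑ l, r l : ℕ)) = M r * (α m + c * r m) := by
  obtain ⟨H, hH⟩ := hM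
  obtain ⟨m₁, m₂, h12⟩ := exists_pair_ne ι
  have hHpos (n : ℕ) : 0 < H n := by
    simpa [hH _ _ _ h12] using
      crossRatio_pos hpos (Pi.single m₁ n) (Pi.single m₁ 1) (Pi.single m₂ 1)
  let φ : ℕ → ℝ := fun n => ∏ t ∈ Finset.range n, H t
  have hφpos (n : ℕ) : 0 < φ n := Finset.prod_pos fun t _ => hHpos t
  -- The normalization by `φ` cancels the cross ratios.
  let g : ι → (ι → ℕ) → ℝ := fun m r => M (r + Pi.single m 1) / (M r * φ (∑ l, r l))
  have hgpos (m : ι) (r : ι → ℕ) : 0 < g m r := div_pos (hpos _) (mul_pos (hpos _) (hφpos _))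
  have hg (m m' : ι) (r : ι → ℕ) (hm : m ≠ m') : g m (r + Pi.single m' 1) = g m r := by
    have h : M r * M (r + Pi.single m 1 + Pi.single m' 1) =
        H (∑ l, r l) * (M (r + Pi.single m 1) * M (r + Pi.single m' 1)) := by
      rw [← hH r m m' hm, crossRatio, div_mul_cancel₀ _ (mul_pos (hpos _) (hpos _)).ne']
    simp only [g, sum_add_single_one, φ, Finset.prod_range_succ]
    rw [div_eq_div_iff (mul_pos (hpos _) (mul_pos (hφpos _) (hHpos _))).ne'
      (mul_pos (hpos _) (hφpos _)).ne', add_right_comm]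
    linear_combination φ (∑ l, r l) * h
  have hgsum (r : ι → ℕ) : ∑ m, g m r = (φ (∑ l, r l))⁻¹ := by
    simp only [g]
    rw [← Finset.sum_div, hsum, div_mul_eq_div_div, div_self (hpos r).ne', one_div]
  obtain ⟨c, hc⟩ := exists_forall_eq_add_nsmul hg (S := fun n => (φ n)⁻¹) hgsum
  refine ⟨fun m => g m 0, c, fun m => hgpos m 0, ?_, fun r m => ?_⟩
  · by_contra! hneg
    obtain ⟨n, hn⟩ := exists_lt_nsmul (neg_pos.2 hneg) (g m₁ 0)
    have := hgpos m₁ (Pi.single m₁ n)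
    rw [hc, Pi.single_eq_same] at this
    simp only [smul_neg] at hn
    linarith
  · have hφ : ∑ l, g l 0 + c * (∑ l, r l : ℕ) = (φ (∑ l, r l))⁻¹ := by
      rw [← hgsum, Finset.sum_congr rfl fun l _ => hc l r, Finset.sum_add_distrib,
        ← Finset.sum_smul, nsmul_eq_mul, mul_comm]
    have hα : g m 0 + c * r m = g m r := by rw [hc m r, nsmul_eq_mul, mul_comm]
    rw [hφ, hα]
    simp only [g]
    have := (hpos r).ne'
    field_simp

end MultiIndex

/-! ### Measures determined by moments -/

section Moments

open scoped BoundedContinuousFunction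

variable {X ι : Type*} [TopologicalSpace X]

/-- The algebra of polynomials in the continuous functions `f m`. -/
def polynomialSubalgebra (f : ι → X →ᵇ ℝ) : StarSubalgebra ℝ (X →ᵇ ℝ) where
  toSubalgebra := (MvPolynomial.aeval (R := ℝ) f).range
  star_mem' {g} hg := by
    have : star g = g := by ext; simp
    rwa [this]

lemma mem_polynomialSubalgebra (f : ι → X →ᵇ ℝ) (m : ι) : f m ∈ polynomialSubalgebra f :=
  ⟨MvPolynomial.X m, by simp⟩

variable [Fintype ι]

lemma integral_aeval [MeasurableSpace X] [OpensMeasurableSpace X] (ν : Measure X)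
    [IsFiniteMeasure ν] (f : ι → X →ᵇ ℝ) (P : MvPolynomial ι ℝ) :
    ∫ y, MvPolynomial.aeval f P y ∂ν = ∑ d ∈ P.support, P.coeff d * ∫ y, ∏ m, f m y ^ d m ∂ν := by
  have heval (y : X) : MvPolynomial.aeval f P y =
      ∑ d ∈ P.support, P.coeff d * (∏ m, f m ^ d m : X →ᵇ ℝ) y := by
    rw [MvPolynomial.aeval_def, MvPolynomial.eval₂_eq', BoundedContinuousFunction.coe_sum,
      Finset.sum_apply]
    rfl
  simp_rw [heval]
  rw [integral_finsetSum _ fun d _ => (BoundedContinuousFunction.integrable ν _).const_mul _]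
  simp only [integral_const_mul, BoundedContinuousFunction.coe_prod, Finset.prod_apply,
    BoundedContinuousFunction.coe_pow, Pi.pow_apply]

lemma ext_of_integral_prod_pow_eq [CompactSpace X] [PolishSpace X] [MeasurableSpace X]
    [BorelSpace X] {ν ν' : Measure X} [IsFiniteMeasure ν] [IsFiniteMeasure ν'] (f : ι → X →ᵇ ℝ)
    (hf : ∀ ⦃x y⦄, x ≠ y → ∃ m, f m x ≠ f m y)
    (h : ∀ r : ι → ℕ, ∫ x, ∏ m, f m x ^ r m ∂ν = ∫ x, ∏ m, f m x ^ r m ∂ν') : ν = ν' := by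
  refine ext_of_forall_mem_subalgebra_integral_eq_of_polish (A := polynomialSubalgebra f) ?_ ?_
  · intro x y hxy
    obtain ⟨m, hm⟩ := hf hxy
    exact ⟨f m, ⟨BoundedContinuousFunction.toContinuousMapStarₐ ℝ (f m),
      ⟨f m, mem_polynomialSubalgebra f m, rfl⟩, rfl⟩, hm⟩
  · rintro g ⟨P, rfl⟩
    exact (integral_aeval ν f P).trans
      (by simp_rw [h]; exact (integral_aeval ν' f P).symm)

lemma ext_of_moments_eq {K : Set (ι → ℝ)} (hK : IsCompact K) {ν ν' : Measure (ι → ℝ)}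
    [IsFiniteMeasure ν] [IsFiniteMeasure ν'] (hν : ∀ᵐ y ∂ν, y ∈ K) (hν' : ∀ᵐ y ∂ν', y ∈ K)
    (h : ∀ r : ι → ℕ, ∫ y, ∏ m, y m ^ r m ∂ν = ∫ y, ∏ m, y m ^ r m ∂ν') : ν = ν' := by
  have : CompactSpace K := isCompact_iff_compactSpace.1 hK
  have : PolishSpace K := hK.isClosed.polishSpace
  have hKm : MeasurableSet K := hK.isClosed.measurableSet
  let f (m : ι) : K →ᵇ ℝ := BoundedContinuousFunction.mkOfCompact ⟨fun y => (y : ι → ℝ) m,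
    (continuous_apply m).comp continuous_subtype_val⟩
  suffices ν.comap ((↑) : K → ι → ℝ) = ν'.comap (↑) by
    rw [← Measure.restrict_eq_self_of_ae_mem hν, ← Measure.restrict_eq_self_of_ae_mem hν',
      ← map_comap_subtype_coe hKm, ← map_comap_subtype_coe hKm, this]
  refine ext_of_integral_prod_pow_eq f (fun x y hxy => ?_) fun r => ?_
  · obtain ⟨m, hm⟩ := Function.ne_iff.1 (Subtype.coe_ne_coe.2 hxy)
    exact ⟨m, hm⟩
  · have hint (ρ : Measure (ι → ℝ)) (hρ : ∀ᵐ y ∂ρ, y ∈ K) :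
        ∫ x, ∏ m, f m x ^ r m ∂ρ.comap (↑) = ∫ y, ∏ m, y m ^ r m ∂ρ := by
      refine (integral_subtype_comap hKm fun y : ι → ℝ => ∏ m, y m ^ r m).trans ?_
      rw [Measure.restrict_eq_self_of_ae_mem hρ]
    rw [hint ν hν, hint ν' hν', h]

end Moments

/-! ### The Dirichlet integral -/

section DirichletIntegral

open Real

lemma lintegral_comp_smul {E : Type*} [NormedAddCommGroup E] [NormedSpace ℝ E]
    [FiniteDimensional ℝ E] [MeasurableSpace E] [BorelSpace E] (μ : Measure E) [μ.IsAddHaarMeasure]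
    (f : E → ENNReal) {s : ℝ} (hs : s ≠ 0) :
    ∫⁻ x, f (s • x) ∂μ = ENNReal.ofReal |(s ^ Module.finrank ℝ E)⁻¹| * ∫⁻ x, f x ∂μ := by
  rw [← smul_eq_mul, ← lintegral_smul_measure, ← Measure.map_addHaar_smul μ hs]
  exact ((Homeomorph.smulOfNeZero s hs).measurableEmbedding.lintegral_map f).symm

/-- The power function with exponent `a - 1`, the integrand of the Dirichlet integral, extended by
zero to the nonpositive numbers. -/
def powPos (a t : ℝ) : ℝ := if 0 < t then t ^ (a - 1) else 0

lemma powPos_nonneg (a t : ℝ) : 0 ≤ powPos a t := by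
  unfold powPos
  split_ifs with h
  · positivity
  · rfl

@[fun_prop]
lemma measurable_powPos (a : ℝ) : Measurable (powPos a) :=
  Measurable.ite measurableSet_Ioi (by fun_prop) measurable_const

lemma powPos_mul {a s t : ℝ} (hs : 0 < s) : powPos a (s * t) = s ^ (a - 1) * powPos a t := by
  unfold powPos
  by_cases ht : 0 < t
  · rw [if_pos (mul_pos hs ht), if_pos ht, mul_rpow hs.le ht.le]
  · rw [if_neg (fun h => ht (pos_of_mul_pos_right h hs.le)), if_neg ht, mul_zero]

lemma exp_mul_powPos_eq_indicator (a : ℝ) : (fun t => exp (-t) * powPos a t) =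
    (Set.Ioi (0 : ℝ)).indicator fun t => exp (-t) * t ^ (a - 1) := by
  ext t
  simp [powPos, Set.indicator_apply]

lemma integrable_exp_mul_powPos {a : ℝ} (ha : 0 < a) :
    Integrable fun t => exp (-t) * powPos a t := by
  rw [exp_mul_powPos_eq_indicator, integrable_indicator_iff measurableSet_Ioi]
  exact Real.GammaIntegral_convergent ha

lemma integral_exp_mul_powPos {a : ℝ} (ha : 0 < a) :
    ∫ t, exp (-t) * powPos a t = Gamma a := by
  rw [exp_mul_powPos_eq_indicator, integral_indicator measurableSet_Ioi, Gamma_eq_integral ha]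

lemma lintegral_exp_mul_powPos {a : ℝ} (ha : 0 < a) :
    ∫⁻ t, ENNReal.ofReal (exp (-t) * powPos a t) = ENNReal.ofReal (Gamma a) := by
  rw [← ofReal_integral_eq_lintegral_ofReal (integrable_exp_mul_powPos ha)
    (.of_forall fun t => mul_nonneg (exp_pos _).le (powPos_nonneg _ _)),
    integral_exp_mul_powPos ha]

variable {κ : Type*} [Fintype κ]

/-- The unnormalized density of the Dirichlet distribution with parameters `a`, `α` on the simplex
of size `s`, in the coordinates belonging to `α`. -/
def simplexDensity (a : ℝ) (α : κ → ℝ) (s : ℝ) (x : κ → ℝ) : ℝ :=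
  powPos a (s - ∑ m, x m) * ∏ m, powPos (α m) (x m)

@[fun_prop]
lemma measurable_simplexDensity (a : ℝ) (α : κ → ℝ) (s : ℝ) :
    Measurable (simplexDensity a α s) := by
  unfold simplexDensity
  fun_prop

lemma simplexDensity_nonneg (a : ℝ) (α : κ → ℝ) (s : ℝ) (x : κ → ℝ) :
    0 ≤ simplexDensity a α s x :=
  mul_nonneg (powPos_nonneg _ _) (Finset.prod_nonneg fun _ _ => powPos_nonneg _ _)

lemma simplexDensity_of_nonpos (a : ℝ) (α : κ → ℝ) {s : ℝ} (hs : s ≤ 0) (x : κ → ℝ) :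
    simplexDensity a α s x = 0 := by
  by_cases h : ∀ m, 0 < x m
  · have : 0 ≤ ∑ m, x m := Finset.sum_nonneg fun m _ => (h m).le
    rw [simplexDensity, powPos, if_neg (by linarith), zero_mul]
  · push Not at h
    obtain ⟨m, hm⟩ := h
    rw [simplexDensity,
      Finset.prod_eq_zero (Finset.mem_univ m) (by rw [powPos, if_neg hm.not_gt]), mul_zero]

lemma simplexDensity_smul (a : ℝ) (α : κ → ℝ) {s : ℝ} (hs : 0 < s) (x : κ → ℝ) :
    simplexDensity a α s (s • x) =
      s ^ (a - 1) * (∏ m, s ^ (α m - 1)) * simplexDensity a α 1 x := by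
  have hsum : s - ∑ m, (s • x) m = s * (1 - ∑ m, x m) := by simp [mul_sub, Finset.mul_sum]
  simp_rw [simplexDensity, hsum, Pi.smul_apply, smul_eq_mul, powPos_mul hs,
    Finset.prod_mul_distrib]
  ring

/-- The total mass of `simplexDensity a α s`. It is an extended nonnegative real because its
finiteness is only obtained along with its value. -/
def simplexIntegral (a : ℝ) (α : κ → ℝ) (s : ℝ) : ENNReal :=
  ∫⁻ x, ENNReal.ofReal (simplexDensity a α s x)

lemma simplexIntegral_eq_powPos_mul (a : ℝ) (α : κ → ℝ) (s : ℝ) :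
    simplexIntegral a α s =
      ENNReal.ofReal (powPos (a + ∑ m, α m) s) * simplexIntegral a α 1 := by
  rcases le_or_gt s 0 with hs | hs
  · rw [simplexIntegral, powPos, if_neg hs.not_gt]
    simp [simplexDensity_of_nonpos a α hs]
  · have hscale := lintegral_comp_smul volume
      (fun x => ENNReal.ofReal (simplexDensity a α s x)) hs.ne'
    simp_rw [simplexDensity_smul a α hs] at hscale
    rw [Module.finrank_fintype_fun_eq_card, abs_of_pos (by positivity)] at hscale
    simp_rw [ENNReal.ofReal_mul (show 0 ≤ s ^ (a - 1) * ∏ m, s ^ (α m - 1) by positivity)]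
      at hscale
    rw [lintegral_const_mul _ (by fun_prop)] at hscale
    have hexp : s ^ (a + ∑ m, α m - 1) =
        s ^ Fintype.card κ * (s ^ (a - 1) * ∏ m, s ^ (α m - 1)) := by
      rw [← rpow_sum_of_pos hs, ← rpow_natCast, ← rpow_add hs, ← rpow_add hs]
      congr 1
      simp only [Finset.sum_sub_distrib, Finset.sum_const, Finset.card_univ, nsmul_eq_mul, mul_one]
      ring
    rw [powPos, if_pos hs, hexp, ENNReal.ofReal_mul (by positivity), mul_assoc]
    unfold simplexIntegral
    rw [hscale, ← mul_assoc, ← ENNReal.ofReal_mul (by positivity),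
      mul_inv_cancel₀ (by positivity), ENNReal.ofReal_one, one_mul]

lemma lintegral_exp_mul_prod_powPos {α : κ → ℝ} (hα : ∀ m, 0 < α m) :
    ∫⁻ x : κ → ℝ, ENNReal.ofReal (∏ m, (exp (-x m) * powPos (α m) (x m))) =
      ENNReal.ofReal (∏ m, Gamma (α m)) := by
  have hint : Integrable fun x : κ → ℝ => ∏ m, (exp (-x m) * powPos (α m) (x m)) :=
    .fintype_prod fun m => integrable_exp_mul_powPos (hα m)
  rw [← ofReal_integral_eq_lintegral_ofReal hint
    (.of_forall fun x => Finset.prod_nonneg fun m _ =>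
      mul_nonneg (exp_pos _).le (powPos_nonneg _ _)),
    integral_fintype_prod_volume_eq_prod (fun m t => exp (-t) * powPos (α m) t)]
  simp_rw [integral_exp_mul_powPos (hα _)]

-- Integrating first over `s`, the translation `s ↦ s + ∑ m, x m` separates the variables.
lemma lintegral_exp_mul_simplexIntegral {a : ℝ} (ha : 0 < a) {α : κ → ℝ} (hα : ∀ m, 0 < α m) :
    ∫⁻ s, ENNReal.ofReal (exp (-s)) * simplexIntegral a α s =
      ENNReal.ofReal (Gamma a * ∏ m, Gamma (α m)) := by
  calc ∫⁻ s, ENNReal.ofReal (exp (-s)) * simplexIntegral a α s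
      = ∫⁻ s, ∫⁻ x, ENNReal.ofReal (exp (-s) * simplexDensity a α s x) := by
        refine lintegral_congr fun s => ?_
        simp_rw [ENNReal.ofReal_mul (exp_pos _).le]
        rw [lintegral_const_mul _ (by fun_prop), simplexIntegral]
    _ = ∫⁻ x : κ → ℝ, ∫⁻ s, ENNReal.ofReal (exp (-s) * simplexDensity a α s x) := by
        refine lintegral_lintegral_swap (Measurable.aemeasurable ?_)
        unfold Function.uncurry simplexDensity
        fun_prop
    _ = ∫⁻ x : κ → ℝ, ENNReal.ofReal (Gamma a) *
          ENNReal.ofReal (∏ m, (exp (-x m) * powPos (α m) (x m))) := by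
        refine lintegral_congr fun x => ?_
        rw [← lintegral_exp_mul_powPos ha, ← lintegral_mul_const _ (by fun_prop),
          ← lintegral_add_right_eq_self _ (∑ m, x m)]
        refine lintegral_congr fun s => ?_
        rw [← ENNReal.ofReal_mul (mul_nonneg (exp_pos _).le (powPos_nonneg _ _)), simplexDensity,
          add_sub_cancel_right, neg_add, exp_add, Finset.prod_mul_distrib, ← exp_sum,
          Finset.sum_neg_distrib]
        congr 1
        ring
    _ = ENNReal.ofReal (Gamma a * ∏ m, Gamma (α m)) := by
        rw [lintegral_const_mul _ (by fun_prop), lintegral_exp_mul_prod_powPos hα,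
          ENNReal.ofReal_mul (Gamma_pos_of_pos ha).le]

-- Compare the two evaluations of the Laplace transform of `simplexIntegral a α` at `1`.
lemma simplexIntegral_one_mul_Gamma {a : ℝ} (ha : 0 < a) {α : κ → ℝ} (hα : ∀ m, 0 < α m) :
    simplexIntegral a α 1 * ENNReal.ofReal (Gamma (a + ∑ m, α m)) =
      ENNReal.ofReal (Gamma a * ∏ m, Gamma (α m)) := by
  have hsum : 0 < a + ∑ m, α m :=
    add_pos_of_pos_of_nonneg ha (Finset.sum_nonneg fun m _ => (hα m).le)
  rw [← lintegral_exp_mul_simplexIntegral ha hα, ← lintegral_exp_mul_powPos hsum,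
    ← lintegral_const_mul _ (by fun_prop)]
  refine lintegral_congr fun s => ?_
  rw [simplexIntegral_eq_powPos_mul a α s, ENNReal.ofReal_mul (exp_pos _).le]
  ring

end DirichletIntegral

/-! ### Moments of laws on the open simplex -/

section SimplexLaw

/-- The open unit simplex, in which the random conditional probability vectors take their values. -/
def posSimplex (ι : Type*) [Fintype ι] : Set (ι → ℝ) := {y | (∀ m, 0 < y m) ∧ ∑ m, y m = 1}

variable {ι : Type*} [Fintype ι]

lemma posSimplex_subset_stdSimplex : posSimplex ι ⊆ stdSimplex ℝ ι :=
  fun _ hy => ⟨fun m => (hy.1 m).le, hy.2⟩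

lemma measurableSet_posSimplex : MeasurableSet (posSimplex ι) := by
  rw [posSimplex, Set.ofPred_and, Set.ofPred_forall]
  exact (MeasurableSet.iInter fun m => measurableSet_lt measurable_const
    (measurable_pi_apply m)).inter (measurableSet_eq_fun (by fun_prop) measurable_const)

/-- The mixed moment of multi-order `r` of the coordinates under `ν`. -/
def moment (ν : Measure (ι → ℝ)) (r : ι → ℕ) : ℝ := ∫ y, ∏ m, y m ^ r m ∂ν

lemma moment_zero (ν : Measure (ι → ℝ)) [IsProbabilityMeasure ν] : moment ν 0 = 1 := by
  simp [moment]

variable {ν : Measure (ι → ℝ)}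

lemma integrable_prod_pow [IsFiniteMeasure ν] (hν : ∀ᵐ y ∂ν, y ∈ posSimplex ι) (r : ι → ℕ) :
    Integrable (fun y : ι → ℝ => ∏ m, y m ^ r m) ν := by
  rw [← Measure.restrict_eq_self_of_ae_mem (hν.mono posSimplex_subset_stdSimplex)]
  exact Continuous.continuousOn (by fun_prop) |>.integrableOn_compact (isCompact_stdSimplex ℝ ι)

lemma moment_pos [IsProbabilityMeasure ν] (hν : ∀ᵐ y ∂ν, y ∈ posSimplex ι) (r : ι → ℕ) :
    0 < moment ν r := by
  have hpos : ∀ᵐ y ∂ν, 0 < ∏ m, y m ^ r m :=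
    hν.mono fun y hy => Finset.prod_pos fun m _ => pow_pos (hy.1 m) _
  refine (integral_pos_iff_support_of_nonneg_ae (hpos.mono fun y hy => hy.le)
    (integrable_prod_pow hν r)).2 ?_
  have hsupp : Function.support (fun y : ι → ℝ => ∏ m, y m ^ r m) =ᵐ[ν] Set.univ :=
    Filter.eventuallyEq_univ.2 (hpos.mono fun y hy => hy.ne')
  rw [measure_congr hsupp, measure_univ]
  exact one_pos

lemma nontrivial_of_nondegenerate (hν : ∀ᵐ y ∂ν, y ∈ posSimplex ι)
    (hnd : ¬ ∃ c, ∀ᵐ y ∂ν, y = c) : Nontrivial ι := by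
  by_contra h
  rw [not_nontrivial_iff_subsingleton] at h
  refine hnd ⟨fun _ => 1, hν.mono fun y hy => funext fun m => ?_⟩
  rw [← hy.2, Fintype.sum_subsingleton _ m]

variable [DecidableEq ι]

lemma prod_pow_add_single (y : ι → ℝ) (r : ι → ℕ) (m : ι) :
    ∏ l, y l ^ (r + Pi.single m 1 : ι → ℕ) l = y m * ∏ l, y l ^ r l := by
  simp only [Pi.add_apply, pow_add, Finset.prod_mul_distrib, Pi.single_apply, pow_ite, pow_one,
    pow_zero, Finset.prod_ite_eq', Finset.mem_univ, if_true, mul_comm]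

lemma sum_moment_add_single [IsFiniteMeasure ν] (hν : ∀ᵐ y ∂ν, y ∈ posSimplex ι) (r : ι → ℕ) :
    ∑ m, moment ν (r + Pi.single m 1) = moment ν r := by
  unfold moment
  rw [← integral_finsetSum _ fun m _ => integrable_prod_pow hν _]
  refine integral_congr_ae (hν.mono fun y hy => ?_)
  simp only [prod_pow_add_single]
  rw [← Finset.sum_mul, hy.2, one_mul]

lemma ae_eq_const_of_moment_single_add_self [IsProbabilityMeasure ν]
    (hν : ∀ᵐ y ∂ν, y ∈ posSimplex ι)
    (h : ∀ m, moment ν (Pi.single m 1 + Pi.single m 1) = moment ν (Pi.single m 1) ^ 2) :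
    ∀ᵐ y ∂ν, y = fun m => moment ν (Pi.single m 1) := by
  have hsingle (m : ι) (y : ι → ℝ) : ∏ l, y l ^ (Pi.single m 1 : ι → ℕ) l = y m := by
    simpa using prod_pow_add_single y 0 m
  have hsq (m : ι) (y : ι → ℝ) :
      ∏ l, y l ^ (Pi.single m 1 + Pi.single m 1 : ι → ℕ) l = y m ^ 2 := by
    rw [prod_pow_add_single, hsingle, sq]
  suffices ∀ m, ∀ᵐ y ∂ν, y m = moment ν (Pi.single m 1) from
    (ae_all_iff.2 this).mono fun y hy => funext hy
  intro m
  have hLp : MemLp (fun y : ι → ℝ => y m) 2 ν := by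
    refine (memLp_two_iff_integrable_sq (measurable_pi_apply m).aestronglyMeasurable).2 ?_
    exact (integrable_prod_pow hν (Pi.single m 1 + Pi.single m 1)).congr (.of_forall (hsq m))
  have hvar : Var[fun y => y m; ν] = 0 := by
    have := h m
    simp only [moment, hsingle, hsq] at this
    rw [variance_eq_sub hLp, sub_eq_zero]
    exact this
  simpa only [moment, hsingle] using ae_eq_integral_of_variance_eq_zero hLp hvar

end SimplexLaw

/-! ### Moments of Dirichlet distributions -/

section DirichletMoments

variable {ι : Type*} [Fintype ι]

/-- The multivariate Beta function, the normalizing constant of the Dirichlet density. -/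
def multiBeta (α : ι → ℝ) : ℝ := (∏ m, Real.Gamma (α m)) / Real.Gamma (∑ m, α m)

lemma multiBeta_pos [Nonempty ι] {α : ι → ℝ} (hα : ∀ m, 0 < α m) : 0 < multiBeta α :=
  div_pos (Finset.prod_pos fun m _ => Real.Gamma_pos_of_pos (hα m))
    (Real.Gamma_pos_of_pos (Finset.sum_pos (fun m _ => hα m) Finset.univ_nonempty))

variable [DecidableEq ι]

lemma multiBeta_add_single {α : ι → ℝ} (hα : ∀ m, 0 < α m) (m : ι) :
    multiBeta (α + Pi.single m 1) * ∑ l, α l = multiBeta α * α m := by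
  have hs : 0 < ∑ l, α l := Finset.sum_pos (fun l _ => hα l) ⟨m, Finset.mem_univ m⟩
  have hsum : ∑ l, (α + Pi.single m 1 : ι → ℝ) l = ∑ l, α l + 1 := by
    simp [Finset.sum_add_distrib]
  have hprod : ∏ l, Real.Gamma ((α + Pi.single m 1 : ι → ℝ) l) =
      α m * ∏ l, Real.Gamma (α l) := by
    rw [← Finset.mul_prod_erase _ _ (Finset.mem_univ m),
      ← Finset.mul_prod_erase _ (fun l => Real.Gamma (α l)) (Finset.mem_univ m), ← mul_assoc,
      ← Real.Gamma_add_one (hα m).ne']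
    congr 1
    · simp
    · exact Finset.prod_congr rfl fun l hl => by simp [Finset.ne_of_mem_erase hl]
  rw [multiBeta, multiBeta, hsum, hprod, Real.Gamma_add_one hs.ne']
  have := (Real.Gamma_pos_of_pos hs).ne'
  field_simp

@[fun_prop]
lemma measurable_complete (m₀ : ι) : Measurable (complete m₀) := by
  refine measurable_pi_lambda _ fun m => ?_
  unfold complete
  split_ifs <;> fun_prop

lemma sum_complete (m₀ : ι) (x : {m // m ≠ m₀} → ℝ) : ∑ m, complete m₀ x m = 1 := by
  rw [Fintype.sum_eq_add_sum_subtype_ne _ m₀]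
  simp only [complete, dite_true]
  rw [Finset.sum_congr rfl fun (m : {m // m ≠ m₀}) _ => dif_neg m.2, sub_add_cancel]

lemma simplexDensity_eq_prod_complete (α : ι → ℝ) (m₀ : ι) (x : {m // m ≠ m₀} → ℝ) :
    simplexDensity (α m₀) (fun m : {m // m ≠ m₀} => α m) 1 x =
      ∏ m, powPos (α m) (complete m₀ x m) := by
  rw [Fintype.prod_eq_mul_prod_subtype_ne _ m₀]
  simp only [simplexDensity, complete, dite_true]
  congr 1
  exact Finset.prod_congr rfl fun m _ => by rw [dif_neg m.2]

lemma dirichletDensity_eq_inv_multiBeta_mul (α : ι → ℝ) (m₀ : ι) (x : {m // m ≠ m₀} → ℝ) :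
    dirichletDensity α m₀ x =
      (multiBeta α)⁻¹ * simplexDensity (α m₀) (fun m : {m // m ≠ m₀} => α m) 1 x := by
  rw [dirichletDensity, multiBeta, inv_div, simplexDensity_eq_prod_complete]
  split_ifs with h
  · congr 1
    exact Finset.prod_congr rfl fun m _ => (if_pos (h m)).symm
  · push Not at h
    obtain ⟨m, hm⟩ := h
    rw [Finset.prod_eq_zero (f := fun m => powPos (α m) (complete m₀ x m)) (Finset.mem_univ m)
      (if_neg hm.not_gt), mul_zero]

@[fun_prop]
lemma measurable_dirichletDensity (α : ι → ℝ) (m₀ : ι) : Measurable (dirichletDensity α m₀) := by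
  rw [funext (dirichletDensity_eq_inv_multiBeta_mul α m₀)]
  fun_prop

lemma ae_mem_posSimplex_dirichletMeasure (α : ι → ℝ) (m₀ : ι) :
    ∀ᵐ y ∂dirichletMeasure α m₀, y ∈ posSimplex ι := by
  have hmem : MeasurableSet {y | y ∈ posSimplex ι} := measurableSet_posSimplex
  rw [dirichletMeasure, ae_map_iff (by fun_prop) hmem, ae_withDensity_iff (by fun_prop)]
  refine .of_forall fun x hx => ⟨?_, sum_complete m₀ x⟩
  by_contra h
  exact hx (by rw [dirichletDensity, if_neg h, ENNReal.ofReal_zero])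

lemma simplexIntegral_one {α : ι → ℝ} (hα : ∀ m, 0 < α m) (m₀ : ι) :
    simplexIntegral (α m₀) (fun m : {m // m ≠ m₀} => α m) 1 = ENNReal.ofReal (multiBeta α) := by
  have hΓ : 0 < Real.Gamma (∑ m, α m) :=
    Real.Gamma_pos_of_pos (Finset.sum_pos (fun m _ => hα m) ⟨m₀, Finset.mem_univ m₀⟩)
  have h := simplexIntegral_one_mul_Gamma (hα m₀) (α := fun m : {m // m ≠ m₀} => α m)
    fun m => hα m
  rw [← Fintype.sum_eq_add_sum_subtype_ne α m₀,
    ← Fintype.prod_eq_mul_prod_subtype_ne (fun m => Real.Gamma (α m)) m₀] at h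
  rw [multiBeta, ENNReal.ofReal_div_of_pos hΓ,
    ENNReal.eq_div_iff (by simpa using hΓ) ENNReal.ofReal_ne_top, mul_comm, h]

lemma simplexDensity_mul_prod_pow (α : ι → ℝ) (m₀ : ι) (r : ι → ℕ) (x : {m // m ≠ m₀} → ℝ) :
    simplexDensity (α m₀) (fun m : {m // m ≠ m₀} => α m) 1 x * ∏ m, complete m₀ x m ^ r m =
      simplexDensity (α m₀ + r m₀) (fun m : {m // m ≠ m₀} => α m + r m) 1 x := by
  rw [simplexDensity_eq_prod_complete, simplexDensity_eq_prod_complete (fun m => α m + r m),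
    ← Finset.prod_mul_distrib]
  refine Finset.prod_congr rfl fun m _ => ?_
  unfold powPos
  split_ifs with h
  · rw [← Real.rpow_natCast, ← Real.rpow_add h, sub_add_eq_add_sub]
  · rw [zero_mul]

lemma lintegral_prod_pow_dirichletMeasure {α : ι → ℝ} (hα : ∀ m, 0 < α m) (m₀ : ι) (r : ι → ℕ) :
    ∫⁻ y, ENNReal.ofReal (∏ m, y m ^ r m) ∂dirichletMeasure α m₀ =
      ENNReal.ofReal ((multiBeta α)⁻¹ * multiBeta fun m => α m + r m) := by
  have : Nonempty ι := ⟨m₀⟩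
  have hB : 0 ≤ (multiBeta α)⁻¹ := inv_nonneg.2 (multiBeta_pos hα).le
  rw [ENNReal.ofReal_mul hB, ← simplexIntegral_one (fun m => by have := hα m; positivity) m₀,
    simplexIntegral, ← lintegral_const_mul _ (by fun_prop), dirichletMeasure,
    lintegral_map (by fun_prop) (by fun_prop),
    lintegral_withDensity_eq_lintegral_mul _ (by fun_prop) (by fun_prop)]
  refine lintegral_congr fun x => ?_
  rw [Pi.mul_apply, dirichletDensity_eq_inv_multiBeta_mul, ← ENNReal.ofReal_mul
    (mul_nonneg hB (simplexDensity_nonneg _ _ _ _)), ← ENNReal.ofReal_mul hB, mul_assoc,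
    simplexDensity_mul_prod_pow]

lemma isProbabilityMeasure_dirichletMeasure {α : ι → ℝ} (hα : ∀ m, 0 < α m) (m₀ : ι) :
    IsProbabilityMeasure (dirichletMeasure α m₀) := by
  have : Nonempty ι := ⟨m₀⟩
  have h := lintegral_prod_pow_dirichletMeasure hα m₀ 0
  simp only [Pi.zero_apply, pow_zero, Finset.prod_const_one, ENNReal.ofReal_one, lintegral_one,
    Nat.cast_zero, add_zero, inv_mul_cancel₀ (multiBeta_pos hα).ne'] at h
  exact ⟨h⟩

lemma moment_dirichletMeasure {α : ι → ℝ} (hα : ∀ m, 0 < α m) (m₀ : ι) (r : ι → ℕ) :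
    moment (dirichletMeasure α m₀) r = (multiBeta α)⁻¹ * multiBeta fun m => α m + r m := by
  have : Nonempty ι := ⟨m₀⟩
  have hB := multiBeta_pos hα
  have hB' : 0 < multiBeta fun m => α m + r m :=
    multiBeta_pos fun m => by have := hα m; positivity
  have hmeas : Measurable fun y : ι → ℝ => ∏ m, y m ^ r m := by fun_prop
  rw [moment, integral_eq_lintegral_of_nonneg_ae _ hmeas.aestronglyMeasurable,
    lintegral_prod_pow_dirichletMeasure hα m₀ r, ENNReal.toReal_ofReal (by positivity)]
  filter_upwards [ae_mem_posSimplex_dirichletMeasure α m₀] with y hy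
  exact Finset.prod_nonneg fun m _ => pow_nonneg (hy.1 m).le _

lemma moment_dirichletMeasure_add_single {α : ι → ℝ} (hα : ∀ m, 0 < α m) (m₀ : ι) (r : ι → ℕ)
    (m : ι) :
    moment (dirichletMeasure α m₀) (r + Pi.single m 1) * (∑ l, α l + (∑ l, r l : ℕ)) =
      moment (dirichletMeasure α m₀) r * (α m + r m) := by
  have h := multiBeta_add_single (α := fun l => α l + r l)
    (fun l => by have := hα l; positivity) m
  have hadd : (fun l => α l + ((r + Pi.single m 1 : ι → ℕ) l : ℝ)) =
      (fun l => α l + r l) + Pi.single m 1 := by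
    ext l
    simp [Pi.single_apply, add_assoc]
  rw [moment_dirichletMeasure hα, moment_dirichletMeasure hα, hadd, Nat.cast_sum,
    ← Finset.sum_add_distrib, mul_assoc, h, mul_assoc]

lemma eq_dirichletMeasure_of_moment_add_single {ν : Measure (ι → ℝ)} [IsProbabilityMeasure ν]
    (hν : ∀ᵐ y ∂ν, y ∈ posSimplex ι) {α : ι → ℝ} (hα : ∀ m, 0 < α m)
    (h : ∀ r m, moment ν (r + Pi.single m 1) * (∑ l, α l + (∑ l, r l : ℕ)) =
      moment ν r * (α m + r m)) (m₀ : ι) :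
    ν = dirichletMeasure α m₀ := by
  have := isProbabilityMeasure_dirichletMeasure hα m₀
  refine ext_of_moments_eq (isCompact_stdSimplex ℝ ι) (hν.mono posSimplex_subset_stdSimplex)
    ((ae_mem_posSimplex_dirichletMeasure α m₀).mono posSimplex_subset_stdSimplex) fun r => ?_
  change moment ν r = moment (dirichletMeasure α m₀) r
  induction r using multiIndex_induction with
  | zero => rw [moment_zero, moment_zero]
  | add_single r m ih =>
    have hs : 0 < ∑ l, α l + (∑ l, r l : ℕ) :=
      add_pos_of_pos_of_nonneg (Finset.sum_pos (fun m _ => hα m) ⟨m₀, Finset.mem_univ m₀⟩)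
        (Nat.cast_nonneg _)
    exact mul_right_cancel₀ hs.ne' (by rw [h, moment_dirichletMeasure_add_single hα, ih])

-- A slope `c = 0` of the predictive probabilities would make all the variances vanish.
lemma isDirichlet_of_crossRatioDependsOnDegree {ν : Measure (ι → ℝ)} [IsProbabilityMeasure ν]
    (hν : ∀ᵐ y ∂ν, y ∈ posSimplex ι) (hnd : ¬ ∃ c, ∀ᵐ y ∂ν, y = c)
    (h : CrossRatioDependsOnDegree (moment ν)) : IsDirichlet ν := by
  have := nontrivial_of_nondegenerate hν hnd
  obtain ⟨α, c, hα, hc, hrec⟩ := h.exists_affine_ratio (moment_pos hν) (sum_moment_add_single hν)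
  have hsum : 0 < ∑ l, α l := Finset.sum_pos (fun m _ => hα m) Finset.univ_nonempty
  obtain hc | rfl := hc.lt_or_eq'
  · refine ⟨inferInstance, fun m => α m / c, fun m => div_pos (hα m) hc, fun m₀ => ?_⟩
    refine eq_dirichletMeasure_of_moment_add_single hν (fun m => div_pos (hα m) hc)
      (fun r m => ?_) m₀
    rw [← Finset.sum_div]
    field_simp
    linear_combination hrec r m
  · refine absurd ⟨_, ae_eq_const_of_moment_single_add_self hν fun m => ?_⟩ hnd
    have h₁ := hrec 0 m
    have h₂ := hrec (Pi.single m 1) m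
    simp only [zero_mul, add_zero, zero_add, moment_zero, one_mul] at h₁ h₂
    exact mul_right_cancel₀ hsum.ne' (by rw [h₂, ← h₁]; ring)

end DirichletMoments

/-! ### Parent counts -/

section Counts

lemma restrict_update {V : Type*} [DecidableEq V] {I : V → Type*} {s : Finset V} {v : V}
    (hv : v ∉ s) (x : ∀ v, I v) (m : I v) :
    (fun u : s => Function.update x v m u) = fun u : s => x u :=
  funext fun u => Function.update_of_ne (ne_of_mem_of_not_mem u.2 hv) _ _

variable {V : Type*} [Fintype V] [DecidableEq V] {I : V → Type*} [∀ v, Fintype (I v)]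
  [∀ v, DecidableEq (I v)]

/-- The numbers of observations with parent configuration `k` at the vertex `v`, sorted by the
value at `v`, in a sample with cell counts `n`. -/
def parentCount (pa : V → Finset V) (v : V) (k : ∀ w : pa v, I w) :
    ((∀ v, I v) → ℕ) →+ (I v → ℕ) where
  toFun n m := ∑ i with (fun w : pa v => i w) = k ∧ i v = m, n i
  map_zero' := by ext; simp
  map_add' n n' := by ext; simp [Finset.sum_add_distrib]

lemma parentCount_apply (pa : V → Finset V) (v : V) (k : ∀ w : pa v, I w) (n : (∀ v, I v) → ℕ)
    (m : I v) :
    parentCount pa v k n m = ∑ i with (fun w : pa v => i w) = k ∧ i v = m, n i := rfl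

lemma parentCount_single (pa : V → Finset V) (v : V) (k : ∀ w : pa v, I w) (i : ∀ v, I v) :
    parentCount pa v k (Pi.single i 1) =
      if (fun w : pa v => i w) = k then Pi.single (i v) 1 else 0 := by
  ext m
  rw [parentCount_apply, Finset.sum_pi_single']
  by_cases hk : (fun w : pa v => i w) = k
  · simp [hk, Pi.single_apply, eq_comm]
  · simp [hk]

/-- The cell counts of a sample with `r m` observations in the cell obtained from `x` by changing
the value at `v` into `m`. -/
def sliceCount (x : ∀ v, I v) (v : V) (r : I v → ℕ) : (∀ v, I v) → ℕ :=
  ∑ m, r m • Pi.single (Function.update x v m) 1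

lemma parentCount_sliceCount_of_ne {pa : V → Finset V} {v w : V} (hv : v ∉ pa w) (hwv : w ≠ v)
    (x : ∀ v, I v) (r : I v → ℕ) :
    parentCount pa w (fun u => x u) (sliceCount x v r) = Pi.single (x w) (∑ m, r m) := by
  simp only [sliceCount, map_sum, map_nsmul, parentCount_single, restrict_update hv, if_true,
    Function.update_of_ne hwv]
  rw [← Finset.sum_smul, ← Pi.single_smul, smul_eq_mul, mul_one]

lemma parentCount_sliceCount_self {pa : V → Finset V} {v : V} (hv : v ∉ pa v)
    (x : ∀ v, I v) (r : I v → ℕ) :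
    parentCount pa v (fun u => x u) (sliceCount x v r) = r := by
  simp only [sliceCount, map_sum, map_nsmul, parentCount_single, restrict_update hv, if_true,
    Function.update_self]
  ext m
  simp [Finset.sum_apply, Pi.single_apply]

/-- The product of functions of the parent counts, one for each vertex and parent configuration:
under parameter independence the joint moments of the cell probabilities have this form. -/
def parentCountProd (pa : V → Finset V) (f : (x : Σ v, ∀ w : pa v, I w) → (I x.1 → ℕ) → ℝ)
    (n : (∀ v, I v) → ℕ) : ℝ :=
  ∏ x, f x (parentCount pa x.1 x.2 n)

variable {pa pa' : V → Finset V} {f : (x : Σ v, ∀ w : pa v, I w) → (I x.1 → ℕ) → ℝ}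
  {f' : (x : Σ v, ∀ w : pa' v, I w) → (I x.1 → ℕ) → ℝ}

lemma crossRatio_parentCountProd (hf : ∀ x r, 0 < f x r) (n : (∀ v, I v) → ℕ) (i j : ∀ v, I v) :
    crossRatio (parentCountProd pa f) n (Pi.single i 1) (Pi.single j 1) =
      ∏ v, if (fun w : pa v => i w) = (fun w : pa v => j w) then
        crossRatio (f ⟨v, fun w => i w⟩) (parentCount pa v (fun w => i w) n)
          (Pi.single (i v) 1) (Pi.single (j v) 1) else 1 := by
  unfold parentCountProd
  rw [crossRatio_prod f (fun x => parentCount pa x.1 x.2), Fintype.prod_sigma]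
  refine Finset.prod_congr rfl fun v _ => ?_
  rw [Fintype.prod_eq_single fun w : pa v => i w]
  · by_cases h : (fun w : pa v => i w) = (fun w : pa v => j w)
    · simp only [parentCount_single, if_true, if_pos h, if_pos h.symm]
    · simp only [parentCount_single, if_true, if_neg h, if_neg (Ne.symm h),
        crossRatio_zero_right (hf _)]
  · intro k hk
    simp only [parentCount_single, if_neg hk.symm, crossRatio_zero_left (hf _)]

-- The parent configurations of the children of `v` differ between the two directions, and at the
-- other vertices the counts of a slice only involve its size: such vertices contribute to `C`.
lemma exists_crossRatio_parentCountProd_sliceCount (hpa : ∀ v, v ∉ pa v)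
    (hf : ∀ x r, 0 < f x r) (v : V) (x y : ∀ v, I v) :
    ∃ C : ℕ → ℝ, (∀ N, 0 < C N) ∧ ∀ (r : I v → ℕ) (m m' : I v), m ≠ m' →
      crossRatio (parentCountProd pa f) (sliceCount x v r)
          (Pi.single (Function.update x v m) 1) (Pi.single (Function.update y v m') 1) =
        (if (fun w : pa v => x w) = (fun w : pa v => y w) then
          crossRatio (f ⟨v, fun w => x w⟩) r (Pi.single m 1) (Pi.single m' 1) else 1) *
          C (∑ l, r l) := by
  refine ⟨fun N => ∏ w ∈ Finset.univ.erase v,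
    if v ∉ pa w ∧ (fun u : pa w => x u) = (fun u : pa w => y u) then
      crossRatio (f ⟨w, fun u => x u⟩) (Pi.single (x w) N) (Pi.single (x w) 1)
        (Pi.single (y w) 1) else 1, fun N => Finset.prod_pos fun w _ => ?_, fun r m m' hm => ?_⟩
  · split_ifs
    exacts [crossRatio_pos (hf _) _ _ _, one_pos]
  · rw [crossRatio_parentCountProd hf, ← Finset.mul_prod_erase _ _ (Finset.mem_univ v)]
    congr 1
    · rw [restrict_update (hpa v), restrict_update (hpa v), parentCount_sliceCount_self (hpa v),
        Function.update_self, Function.update_self]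
    · refine Finset.prod_congr rfl fun w hw => ?_
      have hwv := Finset.ne_of_mem_erase hw
      by_cases hv : v ∈ pa w
      · have hne : (fun u : pa w => Function.update x v m u) ≠
            fun u : pa w => Function.update y v m' u := fun h => by
          simpa [hm] using congrFun h ⟨v, hv⟩
        rw [if_neg hne, if_neg fun h => h.1 hv]
      · rw [restrict_update hv, restrict_update hv, parentCount_sliceCount_of_ne hv hwv,
          Function.update_of_ne hwv, Function.update_of_ne hwv]
        simp only [hv, not_false_eq_true, true_and]

variable (hpa : ∀ v, v ∉ pa v) (hpa' : ∀ v, v ∉ pa' v) (hf : ∀ x r, 0 < f x r)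
  (hf' : ∀ x r, 0 < f' x r) (h : parentCountProd pa f = parentCountProd pa' f') {v : V}
include hpa hpa' hf hf' h

-- Compare the cross ratios in the directions of `x` and of a cell `y` which agrees with `x` exactly
-- on `pa v`, so that the vertex `v` contributes along `pa` only.
lemma crossRatioDependsOnDegree_of_not_subset [∀ v, Nontrivial (I v)] (hv : ¬ pa' v ⊆ pa v)
    (x : ∀ v, I v) : CrossRatioDependsOnDegree (f ⟨v, fun w => x w⟩) := by
  choose z hz using fun w => exists_ne (x w)
  let y : ∀ v, I v := fun w => if w ∈ pa v then x w else z w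
  obtain ⟨C, hC, hC_eq⟩ := exists_crossRatio_parentCountProd_sliceCount hpa hf v x y
  obtain ⟨C', -, hC'_eq⟩ := exists_crossRatio_parentCountProd_sliceCount hpa' hf' v x y
  have hxy : (fun w : pa v => x w) = fun w : pa v => y w := by
    funext w
    simp [y]
  have hxy' : (fun w : pa' v => x w) ≠ fun w : pa' v => y w := by
    obtain ⟨u, hu', hu⟩ := Finset.not_subset.1 hv
    intro hxy
    have hxu : x u = z u := by simpa [y, hu] using congrFun hxy ⟨u, hu'⟩
    exact hz u hxu.symm
  refine ⟨fun N => C' N / C N, fun r m m' hm => ?_⟩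
  have hCC' := hC_eq r m m' hm
  rw [h, hC'_eq r m m' hm, if_pos hxy, if_neg hxy', one_mul] at hCC'
  rw [eq_div_iff (hC _).ne', hCC']

lemma CrossRatioDependsOnDegree.transfer (x : ∀ v, I v)
    (hx : CrossRatioDependsOnDegree (f' ⟨v, fun w => x w⟩)) :
    CrossRatioDependsOnDegree (f ⟨v, fun w => x w⟩) := by
  obtain ⟨H, hH⟩ := hx
  obtain ⟨C, hC, hC_eq⟩ := exists_crossRatio_parentCountProd_sliceCount hpa hf v x x
  obtain ⟨C', -, hC'_eq⟩ := exists_crossRatio_parentCountProd_sliceCount hpa' hf' v x x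
  refine ⟨fun N => H N * C' N / C N, fun r m m' hm => ?_⟩
  have hCC' := hC_eq r m m' hm
  rw [h, hC'_eq r m m' hm, if_pos rfl, if_pos rfl, hH r m m' hm] at hCC'
  rw [eq_div_iff (hC _).ne', hCC']

lemma crossRatioDependsOnDegree_of_ne [∀ v, Nontrivial (I v)] (hv : pa v ≠ pa' v)
    (x : ∀ v, I v) : CrossRatioDependsOnDegree (f ⟨v, fun w => x w⟩) := by
  by_cases hsub : pa' v ⊆ pa v
  · exact .transfer hpa hpa' hf hf' h x <| crossRatioDependsOnDegree_of_not_subset hpa' hpa hf' hf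
      h.symm (fun hsub' => hv (hsub'.antisymm hsub)) x
  · exact crossRatioDependsOnDegree_of_not_subset hpa hpa' hf hf' h hsub x

end Counts

/-! ### The laws of the conditional vectors -/

section CondParam

variable {V : Type*} {I : V → Type*} {pa : V → Finset V} {v : V}

lemma IsMoralDAG.notMem_self {G : SimpleGraph V} (h : IsMoralDAG G pa) (v : V) : v ∉ pa v :=
  fun hv => h.acyclic v (.single hv)

lemma exists_cell [Nonempty (∀ v, I v)] (hv : v ∉ pa v) (k : ∀ w : pa v, I w) (m : I v) :
    ∃ i : ∀ v, I v, (fun w : pa v => i w) = k ∧ i v = m := by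
  classical
  obtain ⟨i₀⟩ := ‹Nonempty (∀ v, I v)›
  refine ⟨Function.update (fun w => if h : w ∈ pa v then k ⟨w, h⟩ else i₀ w) v m, ?_,
    Function.update_self _ _ _⟩
  rw [restrict_update hv]
  funext w
  exact dif_pos w.2

variable [Fintype V] [DecidableEq V] [∀ v, Fintype (I v)] {q : (∀ v, I v) → ℝ}

lemma condParam_update_eq_div (q : (∀ v, I v) → ℝ) (hv : v ∉ pa v) (i : ∀ v, I v) (m : I v) :
    condParam q pa v (fun w => i w) m =
      marginal q (insert v (pa v)) (Function.update i v m) / marginal q (pa v) i := by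
  have h := condParam_eq_marginal_div q pa v (Function.update i v m)
  rwa [restrict_update hv, Function.update_self, marginal_update_of_notMem q hv] at h

lemma condParam_mem_posSimplex [Nonempty (∀ v, I v)] (hq : ∀ i, 0 < q i) (hv : v ∉ pa v)
    (k : ∀ w : pa v, I w) : condParam q pa v k ∈ posSimplex (I v) := by
  obtain ⟨i, rfl, -⟩ := exists_cell hv k (Classical.arbitrary (∀ v, I v) v)
  constructor
  · intro m
    rw [condParam_update_eq_div q hv]
    exact div_pos (marginal_pos hq _ _) (marginal_pos hq _ _)
  · simp only [condParam_update_eq_div q hv, ← Finset.sum_div, sum_marginal_insert_update q hv]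
    exact div_self (marginal_pos hq _ _).ne'

lemma measurable_prob (A : Set (∀ v, I v)) :
    Measurable fun q : (∀ v, I v) → ℝ => prob q A := by
  classical
  refine Finset.measurable_sum _ fun i _ => ?_
  simp only [Set.indicator_apply]
  split_ifs
  exacts [measurable_pi_apply i, measurable_const]

lemma measurable_condParam (pa : V → Finset V) (v : V) (k : ∀ w : pa v, I w) :
    Measurable fun q : (∀ v, I v) → ℝ => condParam q pa v k :=
  measurable_pi_lambda _ fun _ => (measurable_prob _).div (measurable_prob _)

lemma FactorizesAlong.prod_pow_eq [∀ v, DecidableEq (I v)] (hq : FactorizesAlong q pa)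
    (n : (∀ v, I v) → ℕ) :
    ∏ i, q i ^ n i = ∏ x : Σ v, ∀ w : pa v, I w,
      ∏ m, condParam q pa x.1 x.2 m ^ parentCount pa x.1 x.2 n m := by
  have hfiber (v : V) : ∏ i : ∀ v, I v, condParam q pa v (fun w => i w) (i v) ^ n i =
      ∏ k : ∀ w : pa v, I w, ∏ m, condParam q pa v k m ^ parentCount pa v k n m := by
    rw [← Fintype.prod_prod_type', ← Finset.prod_fiberwise Finset.univ
      fun i : ∀ v, I v => ((fun w : pa v => i w), i v)]
    refine Finset.prod_congr rfl fun y _ => ?_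
    rw [parentCount_apply, ← Finset.prod_pow_eq_pow_sum]
    simp only [Prod.ext_iff]
    refine Finset.prod_congr rfl fun i hi => ?_
    rw [(Finset.mem_filter.1 hi).2.1, (Finset.mem_filter.1 hi).2.2]
  calc ∏ i, q i ^ n i
      = ∏ v, ∏ i : ∀ v, I v, condParam q pa v (fun w => i w) (i v) ^ n i := by
        rw [Finset.prod_comm]
        exact Finset.prod_congr rfl fun i _ => by rw [Finset.prod_pow, ← hq i]
    _ = _ := by simp only [hfiber, Fintype.prod_sigma]

end CondParam

section CondLaw

variable {V : Type*} [Fintype V] [DecidableEq V] {I : V → Type*} [∀ v, Fintype (I v)]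
  {Ω : Type*} [MeasurableSpace Ω] {μ : Measure Ω} {p : Ω → (∀ v, I v) → ℝ} {pa pa' : V → Finset V}

/-- The law of the random vector `(ℙ (X v = m | X_{pa v} = k))_m`. -/
def condLaw (p : Ω → (∀ v, I v) → ℝ) (μ : Measure Ω) (pa : V → Finset V) (v : V)
    (k : ∀ w : pa v, I w) : Measure (I v → ℝ) :=
  μ.map fun ω => condParam (p ω) pa v k

lemma IsAssociated.ae_factorizesAlong {G : SimpleGraph V} (hp : IsAssociated G p μ)
    (hpa : IsMoralDAG G pa) : ∀ᵐ ω ∂μ, FactorizesAlong (p ω) pa := by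
  filter_upwards [hp.pos, hp.sum_eq_one, hp.markov] with ω hpos hsum hmarkov
  exact hmarkov.factorizesAlong hpos hsum hpa

lemma ParameterIndependence.nonempty_cells (hind : ParameterIndependence pa p μ) {v : V}
    (k : ∀ w : pa v, I w) : Nonempty (∀ v, I v) := by
  by_contra h
  rw [not_nonempty_iff] at h
  exact (hind.1 v).2 k ⟨condParam 0 pa v k, .of_forall fun ω =>
    congrArg (condParam · pa v k) (Subsingleton.elim (p ω) 0)⟩

section Measurable

variable (hp : Measurable p)
include hp

lemma aemeasurable_condParam (pa : V → Finset V) (v : V) (k : ∀ w : pa v, I w) :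
    AEMeasurable (fun ω => condParam (p ω) pa v k) μ :=
  ((measurable_condParam pa v k).comp hp).aemeasurable

lemma ParameterIndependence.iIndepFun_sigma (hind : ParameterIndependence pa p μ) :
    iIndepFun (fun (x : Σ v, ∀ w : pa v, I w) ω => condParam (p ω) pa x.1 x.2) μ :=
  iIndepFun_uncurry (X := fun v k ω => condParam (p ω) pa v k)
    (fun v k => (measurable_condParam pa v k).comp hp) hind.2.1 fun v => (hind.1 v).1

lemma isProbabilityMeasure_condLaw [IsProbabilityMeasure μ] (pa : V → Finset V) (v : V)
    (k : ∀ w : pa v, I w) : IsProbabilityMeasure (condLaw p μ pa v k) :=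
  Measure.isProbabilityMeasure_map (aemeasurable_condParam hp pa v k)

lemma ae_condLaw_mem_posSimplex (hpos : ∀ᵐ ω ∂μ, ∀ i, 0 < p ω i)
    [Nonempty (∀ v, I v)] {v : V} (hv : v ∉ pa v) (k : ∀ w : pa v, I w) :
    ∀ᵐ y ∂condLaw p μ pa v k, y ∈ posSimplex (I v) := by
  refine (ae_map_iff (aemeasurable_condParam hp pa v k) measurableSet_posSimplex).2 ?_
  filter_upwards [hpos] with ω hω using condParam_mem_posSimplex hω hv k

lemma moment_condLaw (v : V) (k : ∀ w : pa v, I w) (r : I v → ℕ) :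
    moment (condLaw p μ pa v k) r = ∫ ω, ∏ m, condParam (p ω) pa v k m ^ r m ∂μ := by
  rw [moment, condLaw, integral_map (aemeasurable_condParam hp pa v k)
    (by fun_prop : Measurable fun y : I v → ℝ => ∏ m, y m ^ r m).aestronglyMeasurable]

lemma ParameterIndependence.nondegenerate_condLaw (hind : ParameterIndependence pa p μ) (v : V)
    (k : ∀ w : pa v, I w) : ¬ ∃ c, ∀ᵐ y ∂condLaw p μ pa v k, y = c := fun ⟨c, hc⟩ =>
  (hind.1 v).2 k ⟨c, ae_of_ae_map (aemeasurable_condParam hp pa v k) hc⟩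

lemma ParameterIndependence.integral_prod_pow_eq [∀ v, DecidableEq (I v)]
    (hind : ParameterIndependence pa p μ) (hfac : ∀ᵐ ω ∂μ, FactorizesAlong (p ω) pa) :
    (fun n => ∫ ω, ∏ i, p ω i ^ n i ∂μ) =
      parentCountProd pa fun x => moment (condLaw p μ pa x.1 x.2) := by
  funext n
  simp only [parentCountProd, moment_condLaw hp]
  rw [← (hind.iIndepFun_sigma hp).integral_fun_prod_comp
    (f := fun x y => ∏ m, y m ^ parentCount pa x.1 x.2 n m)
    (fun x => aemeasurable_condParam hp pa x.1 x.2) fun x =>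
      Measurable.aestronglyMeasurable (by fun_prop)]
  refine integral_congr_ae ?_
  filter_upwards [hfac] with ω hω using hω.prod_pow_eq n

lemma ParameterIndependence.isDirichlet_condLaw [IsProbabilityMeasure μ] [∀ v, DecidableEq (I v)]
    (hpos : ∀ᵐ ω ∂μ, ∀ i, 0 < p ω i)
    (hpa : ∀ v, v ∉ pa v) (hpa' : ∀ v, v ∉ pa' v)
    (hfac : ∀ᵐ ω ∂μ, FactorizesAlong (p ω) pa) (hfac' : ∀ᵐ ω ∂μ, FactorizesAlong (p ω) pa')
    (hind : ParameterIndependence pa p μ) (hind' : ParameterIndependence pa' p μ)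
    {v : V} (hv : pa v ≠ pa' v) (k : ∀ w : pa v, I w) :
    IsDirichlet (condLaw p μ pa v k) := by
  have := hind.nonempty_cells k
  have hprob := isProbabilityMeasure_condLaw (μ := μ) hp
  obtain ⟨x, rfl, -⟩ := exists_cell (hpa v) k (Classical.arbitrary (∀ v, I v) v)
  have hnontrivial (w : V) : Nontrivial (I w) :=
    nontrivial_of_nondegenerate (ae_condLaw_mem_posSimplex hp hpos (hpa w) fun u => x u)
      (hind.nondegenerate_condLaw hp w _)
  have hmoments := (hind.integral_prod_pow_eq hp hfac).symm.trans
    (hind'.integral_prod_pow_eq hp hfac')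
  have hdeg := crossRatioDependsOnDegree_of_ne hpa hpa'
    (fun y r => moment_pos (ae_condLaw_mem_posSimplex hp hpos (hpa y.1) y.2) r)
    (fun y r => moment_pos (ae_condLaw_mem_posSimplex hp hpos (hpa' y.1) y.2) r) hmoments hv x
  exact isDirichlet_of_crossRatioDependsOnDegree (ae_condLaw_mem_posSimplex hp hpos (hpa v) _)
    (hind.nondegenerate_condLaw hp v _) hdeg

end Measurable

end CondLaw

end

end PDirichlet

theorem mainTheorem1_general {V : Type*} [Fintype V] [DecidableEq V]
    {I : V → Type*} [∀ v, Fintype (I v)] [∀ v, DecidableEq (I v)]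
    {Ω : Type*} [MeasurableSpace Ω] (μ : Measure Ω) [IsProbabilityMeasure μ]
    (P : Set (V → Finset V)) (hP : ∀ pa ∈ P, ∀ v, v ∉ pa v) (hsep : PDirichlet.IsSeparating P)
    (p : Ω → (∀ v, I v) → ℝ) (hp : Measurable p) (hpos : ∀ᵐ ω ∂μ, ∀ i, 0 < p ω i)
    (hfac : ∀ pa ∈ P, ∀ᵐ ω ∂μ, PDirichlet.FactorizesAlong (p ω) pa)
    (hind : ∀ pa ∈ P, PDirichlet.ParameterIndependence pa p μ) :
    ∀ pa ∈ P,
      iIndepFun (fun (x : Σ v, ∀ w : pa v, I w) ω => PDirichlet.condParam (p ω) pa x.1 x.2) μ ∧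
      ∀ v, ∀ k : ∀ w : pa v, I w,
        PDirichlet.IsDirichlet (μ.map fun ω => PDirichlet.condParam (p ω) pa v k) := by
  intro pa hpa
  refine ⟨(hind pa hpa).iIndepFun_sigma hp, fun v k => ?_⟩
  obtain ⟨pa', hpa', hne⟩ : ∃ pa' ∈ P, pa v ≠ pa' v := by
    obtain ⟨pa₁, h₁, pa₂, h₂, hne⟩ := hsep v
    by_cases h : pa v = pa₁ v
    exacts [⟨pa₂, h₂, h.trans_ne hne⟩, ⟨pa₁, h₁, h⟩]
  exact (hind pa hpa).isDirichlet_condLaw hp hpos (hP pa hpa) (hP pa' hpa') (hfac pa hpa)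
    (hfac pa' hpa') (hind pa' hpa') hne k

theorem mainTheorem1 {V : Type*} [Fintype V] [DecidableEq V]
    {I : V → Type*} [∀ v, Fintype (I v)] [∀ v, DecidableEq (I v)]
    {Ω : Type*} [MeasurableSpace Ω] (μ : Measure Ω) [IsProbabilityMeasure μ]
    (G : SimpleGraph V) (hG : PDirichlet.IsDecomposable G)
    (P : Set (V → Finset V)) (hP : ∀ pa ∈ P, PDirichlet.IsMoralDAG G pa)
    (hsep : PDirichlet.IsSeparating P)
    (p : Ω → (∀ v, I v) → ℝ) (hp : PDirichlet.IsAssociated G p μ)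
    (hind : ∀ pa ∈ P, PDirichlet.ParameterIndependence pa p μ) :
    PDirichlet.IsFamilyDirichlet G P p μ := by
  intro pa hpa
  have ⟨hindep, hdirichlet⟩ := mainTheorem1_general μ P (fun pa hpa => (hP pa hpa).notMem_self)
    hsep p hp.measurable hp.pos (fun pa hpa => hp.ae_factorizesAlong (hP pa hpa)) hind pa hpa
  exact ⟨hp, hp.ae_factorizesAlong (hP pa hpa), hindep, hdirichlet⟩
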